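/- Let $k\ge 1$ and $n\ge k+1$ be integers. **Forces.** A *force system* consists of finitely many nondegenerate $(k-1)$-simplices $s_1,\dots,s_l$ in $\mathbb R^n$ (arbitrary, possibly overlapping) and constant vectors $\mathbf F_1,\dots,\mathbf F_l\in\mathbb R^n$, the force $\mathbf F_i$ being distributed uniformly over $s_i$. It is *in equilibrium* if its net force and its net torque vanish, $$\sum_{i=1}^l \mathbf F_i=0,\qquad \sum_{i=1}^l \mathbf F_i\wedge \hat s_i=0,$$ where $\hat s_i$ is the barycenter of $s_i$. **Beams.** Let $\sigma=[a_0,\dots,a_k]$ be a nondegenerate $k$-simplex in $\mathbb R^n$, with facets $\sigma_i$ (opposite to $a_i$), and let $\nu_i$ be the unit vector tangent to $\sigma$ that is normal to $\sigma_i$ and points out of $\sigma$. Let $A$ be a real symmetric $n\times n$ matrix (a constant Cauchy stress tensor). The stressed simplex $A\otimes\sigma$ is *structurally stressed* if every eigenvector of $A$ with nonzero eigenvalue lies in the tangent space of $\sigma$. In that case its boundary forces form the force system $$A\otimes \mathrm{Beam}(\sigma):\qquad \text{the force } \operatorname{area}(\sigma_i)\,A\nu_i \text{ distributed uniformly over }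 \sigma_i,\quad i=0,\dots,k,$$ where $\operatorname{area}$ is the $(k-1)$-dimensional area. Such a system is called a *$k$-beam*. **Theorem.** For every force system $(s_i,\mathbf F_i)_{i\le l}$ in equilibrium there are finitely many structurally stressed $k$-simplices $A_1\otimes\sigma^1,\dots,A_m\otimes\sigma^m$ in $\mathbb R^n$ such that the force system is the sum of the $k$-beams $A_j\otimes\mathrm{Beam}(\sigma^j)$. (Scalar coefficients of a linear combination are absorbed in the matrices $A_j$.) That is, with $\nu^j_i$ the outward unit normal of the facet $\sigma^j_i$, one has the identity of $\mathbb R^n$-valued measures $$\sum_{i=1}^l \mathbf F_i\,\frac{\mathcal H^{k-1}|_{s_i}}{\mathcal H^{k-1}(s_i)}=\sum_{j=1}^m\sum_{i=0}^k \operatorname{area}(\sigma^j_i)\,A_j\nu^j_i\;\frac{\mathcal H^{k-1}|_{\sigma^j_i}}{\mathcal H^{k-1}(\sigma^j_i)},$$ in which each $\mathbf F_i$ is the total force on $s_i$, and with the same beams also the identity without normalization $$\sum_{i=1}^l \mathbf F_i\,\mathcal H^{k-1}|_{s_i}=\sum_{j=1}^m\sum_{i=0}^k \operatorname{area}(\sigma^j_i)\,A_j\nu^j_i\;\mathcal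 H^{k-1}|_{\sigma^j_i}.$$ -/

import Mathlib

open MeasureTheory

noncomputable section

namespace Beams

variable {n : ℕ}

/-- A system of `l` constant forces `force i ∈ ℝⁿ`, the `i`-th one being distributed uniformly over
the (nondegenerate) `d`-simplex `simplex i`. -/
structure ForceSystem (n d l : ℕ) where
  simplex : Fin l → Affine.Simplex ℝ (EuclideanSpace ℝ (Fin n)) d
  force : Fin l → EuclideanSpace ℝ (Fin n)

/-- The wedge product `u ∧ v` of two vectors, as the skew-symmetric matrix `u vᵀ - v uᵀ`. -/
def wedge (u v : EuclideanSpace ℝ (Fin n)) : Matrix (Fin n) (Fin n) ℝ :=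
  Matrix.of fun p q => u p * v q - v p * u q

/-- Equilibrium: the net force and the net torque (about the barycenters) both vanish. -/
def ForceSystem.InEquilibrium {d l : ℕ} (S : ForceSystem n d l) : Prop :=
  ∑ i, S.force i = 0 ∧ ∑ i, wedge (S.force i) (S.simplex i).centroid = 0

/-- The vector measure `F · ℋᵈ|ₛ` (constant density `F`) carried by the closed `d`-simplex `s`;
`μHE[d]` is the `d`-dimensional Hausdorff measure with its Euclidean normalization. -/
def densityForce {d : ℕ} (s : Affine.Simplex ℝ (EuclideanSpace ℝ (Fin n)) d)
    (F : EuclideanSpace ℝ (Fin n)) :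
    VectorMeasure (EuclideanSpace ℝ (Fin n)) (EuclideanSpace ℝ (Fin n)) :=
  (μHE[d].restrict s.closedInterior).withDensityᵥ fun _ => F

/-- The vector measure `F · ℋᵈ|ₛ / ℋᵈ(s)`: the force of total amount `F` distributed uniformly over
the closed `d`-simplex `s`. -/
def uniformForce {d : ℕ} (s : Affine.Simplex ℝ (EuclideanSpace ℝ (Fin n)) d)
    (F : EuclideanSpace ℝ (Fin n)) :
    VectorMeasure (EuclideanSpace ℝ (Fin n)) (EuclideanSpace ℝ (Fin n)) :=
  (ProbabilityTheory.cond μHE[d] s.closedInterior).withDensityᵥ fun _ => F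

/-- The `d`-dimensional area `√(det Gram(a₁ - a₀, …, a_d - a₀)) / d!` of the simplex
`[a₀, …, a_d]`. -/
def area {d : ℕ} (s : Affine.Simplex ℝ (EuclideanSpace ℝ (Fin n)) d) : ℝ :=
  √(Matrix.gram ℝ fun j : Fin d => s.points j.succ - s.points 0).det / (d.factorial : ℝ)

/-- The unit normal to the facet of `σ` opposite to the vertex `i`, tangent to `σ` and pointing
out of `σ`: the normalized vector from the vertex `i` to the foot of its altitude. -/
def outwardNormal {k : ℕ} [NeZero k] (σ : Affine.Simplex ℝ (EuclideanSpace ℝ (Fin n)) k)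
    (i : Fin (k + 1)) : EuclideanSpace ℝ (Fin n) :=
  (σ.height i)⁻¹ • (σ.altitudeFoot i - σ.points i)

/-- A stressed `k`-simplex `A ⊗ σ` of `ℝⁿ`: a `k`-simplex `σ` with a symmetric `n × n` matrix `A`,
its (constant) Cauchy stress tensor. -/
structure StressedSimplex (n k : ℕ) where
  simplex : Affine.Simplex ℝ (EuclideanSpace ℝ (Fin n)) k
  stress : Matrix (Fin n) (Fin n) ℝ
  isSymm : stress.IsSymm

/-- `A ⊗ σ` is structurally stressed if all eigenvectors of `A` for nonzero eigenvalues lie in the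
tangent space of `σ`. -/
def StressedSimplex.IsStructural {k : ℕ} (P : StressedSimplex n k) : Prop :=
  ∀ (c : ℝ) (v : EuclideanSpace ℝ (Fin n)), c ≠ 0 → v ≠ 0 →
    Matrix.toEuclideanLin P.stress v = c • v →
      v ∈ (affineSpan ℝ (Set.range P.simplex.points)).direction

/-- The force that the stress `A` exerts on the facet of `σ` opposite to the vertex `i`:
`A` applied to the outward unit normal is the force per unit area. -/
def StressedSimplex.facetForce {k : ℕ} [NeZero k] (P : StressedSimplex n k) (i : Fin (k + 1)) :
    EuclideanSpace ℝ (Fin n) :=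
  area (P.simplex.faceOpposite i) •
    Matrix.toEuclideanLin P.stress (outwardNormal P.simplex i)

/-- The boundary forces of a stressed `k`-simplex, as a system of forces on its `k + 1` facets.
For a structurally stressed simplex this is the `k`-beam `A ⊗ Beam(σ)`. -/
def StressedSimplex.beam {k : ℕ} [NeZero k] (P : StressedSimplex n k) :
    ForceSystem n (k - 1) (k + 1) where
  simplex i := P.simplex.faceOpposite i
  force i := P.facetForce i

/-- The vector measure `∑ᵢ Fᵢ ℋᵈ|_{sᵢ}`. -/
def ForceSystem.densityMeasure {d l : ℕ} (S : ForceSystem n d l) :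
    VectorMeasure (EuclideanSpace ℝ (Fin n)) (EuclideanSpace ℝ (Fin n)) :=
  ∑ i, densityForce (S.simplex i) (S.force i)

/-- The vector measure `∑ᵢ Fᵢ ℋᵈ|_{sᵢ} / ℋᵈ(sᵢ)`. -/
def ForceSystem.uniformMeasure {d l : ℕ} (S : ForceSystem n d l) :
    VectorMeasure (EuclideanSpace ℝ (Fin n)) (EuclideanSpace ℝ (Fin n)) :=
  ∑ i, uniformForce (S.simplex i) (S.force i)

end Beams

end

/-!
The stress `e eᵀ` along an edge `e = p - q` of a `(d + 1)`-simplex exerts forces on two facets only: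
opposite multiples of `e` on the facets opposite to `p` and `q`. Modulo beams, a force along `e`
thus slides from one of these facets to the other, that is, from a `d`-simplex to the one in which a
vertex `x` is replaced by a vertex `y` with `y - x = e`.

Fix all vertices but one, and let `h x F` be the class modulo beams of the force `F` on the simplex
whose last vertex is `x`. Sliding says `(h y - h x) (y - x) = 0`, the equation satisfied by an
infinitesimal rigid motion, and its solutions are `h x = c + B x` with `B` alternating. As the
order of the vertices does not matter, the class depends on each of them in the same way, so that
the force `F` on `[a₀, …, a_d]` has class `δ F + γ (∑ i, a i) F` with `δ` linear and `γ`
alternating. This depends only on the force and on its torque, so for a system in equilibrium the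
classes add up to zero.
-/

noncomputable section

namespace Beams

open scoped RealInnerProductSpace

section AlmostEverywhere

variable {V : Type*} [NormedAddCommGroup V] [NormedSpace ℝ V]
  [MeasurableSpace V] [BorelSpace V] {μ : Measure V} [μ.IsAddHaarMeasure]
  {Q : Type*} [AddCommGroup Q] [Module ℝ Q]

theorem linearMap_eq_zero_of_ae_eq_const {f : V →ₗ[ℝ] Q} {c : Q} (h : ∀ᵐ v ∂μ, f v = c) :
    f = 0 := by
  ext w
  obtain ⟨v, hv, hwv⟩ := (h.and ((eventually_add_left_iff μ w).2 h)).exists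
  simpa [hv] using hwv

theorem eq_of_affine_compatible {U : V → V → Prop} (hsymm : ∀ x y, U x y → U y x)
    (hgen : ∀ x y, U x y → ∀ᵐ z ∂μ, U z y) {c : V → V →ₗ[ℝ] Q} {B : V → V →ₗ[ℝ] V →ₗ[ℝ] Q}
    (hB : ∀ x y, U x y → (B y).IsAlt) (hcB : ∀ x y, U x y → c y + B y x = c x + B x y)
    {x₀ y x₀' y' : V} (hy : U x₀ y) (hy' : U x₀' y') : B y = B y' := by
  have exchange : ∀ {x x' y y'}, U x y → U x y' → U x' y → U x' y' →
      (B y - B y') (x - x') = (B x - B x') (y - y') := by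
    intro x x' y y' h₁ h₂ h₃ h₄
    have e₁ := hcB _ _ h₁
    have e₂ := hcB _ _ h₂
    have e₃ := hcB _ _ h₃
    have e₄ := hcB _ _ h₄
    simp only [map_sub (B _ - B _), LinearMap.sub_apply]
    grind
  have swap : ∀ {x y y'}, U x y → U x y' → ∀ v w, (B y - B y') v w = -(B y - B y') w v := by
    intro x y y' h h' v w
    simp only [LinearMap.sub_apply, ← (hB _ _ h).neg w v, ← (hB _ _ h').neg w v]
    abel
  have : IsAddTorsionFree Q := .of_isTorsionFree ℝ Q
  obtain ⟨x', hx'y, hx'y'⟩ := ((hgen _ _ hy).and (hgen _ _ hy')).exists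
  rw [← sub_eq_zero]
  refine linearMap_eq_zero_of_ae_eq_const (μ := μ) (c := (B y - B y') x') ?_
  filter_upwards [hgen _ _ hy, hgen _ _ hy'] with x hxy hxy'
  rw [← sub_eq_zero, ← map_sub]
  have hgen₄ : ∀ᵐ z ∂μ, (U z x ∧ U z x') ∧ U z y ∧ U z y' :=
    ((hgen _ _ (hsymm _ _ hxy)).and (hgen _ _ (hsymm _ _ hx'y))).and
      ((hgen _ _ hxy).and (hgen _ _ hxy'))
  obtain ⟨z', ⟨hz'x, hz'x'⟩, hz'y, hz'y'⟩ := hgen₄.exists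
  refine linearMap_eq_zero_of_ae_eq_const (μ := μ) (c := (B y - B y') (x - x') z') ?_
  filter_upwards [hgen₄] with z ⟨⟨hzx, hzx'⟩, hzy, hzy'⟩
  rw [← sub_eq_zero, ← map_sub]
  -- Exchanging the outer pair of points with an inner one and swapping the two arguments, in turn,
  -- returns to the same expression after three swaps, hence with the opposite sign.
  refine self_eq_neg.1 ?_
  calc (B y - B y') (x - x') (z - z')
      = (B x - B x') (y - y') (z - z') := by rw [exchange hxy hxy' hx'y hx'y']
    _ = -(B x - B x') (z - z') (y - y') := swap hzx hzx' _ _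
    _ = -(B z - B z') (x - x') (y - y') := by rw [exchange hzx hzx' hz'x hz'x']
    _ = (B z - B z') (y - y') (x - x') := by
      rw [swap (hsymm _ _ hzy) (hsymm _ _ hz'y) (x - x'), neg_neg]
    _ = (B y - B y') (z - z') (x - x') := by rw [exchange hzy hzy' hz'y hz'y']
    _ = -(B y - B y') (x - x') (z - z') := swap hxy hxy' _ _

variable [FiniteDimensional ℝ V]

theorem span_setOf_eq_top_of_ae {p : V → Prop} (hp : ∀ᵐ v ∂μ, p v) :
    Submodule.span ℝ {v | p v} = ⊤ := by
  by_contra hne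
  obtain ⟨v, hv, hv'⟩ :=
    (hp.and (measure_eq_zero_iff_ae_notMem.1 (Measure.addHaar_submodule μ _ hne))).exists
  exact hv' (Submodule.subset_span hv)

theorem linearMap_ext_ae {f g : V →ₗ[ℝ] Q} (h : ∀ᵐ v ∂μ, f v = g v) : f = g :=
  LinearMap.ext_on (span_setOf_eq_top_of_ae h) fun _ hv => hv

theorem exists_isAlt_of_ae_eq_neg {J : V → V →ₗ[ℝ] Q} {p : V → Prop} (hp : ∀ᵐ u ∂μ, p u)
    (hJ : ∀ u, p u → ∀ᵐ w ∂μ, J u w = -J w u) :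
    ∃ B : V →ₗ[ℝ] V →ₗ[ℝ] Q, B.IsAlt ∧ ∀ u, p u → J u = B u := by
  have hspan := (span_setOf_eq_top_of_ae hp).ge
  let b := Module.Basis.ofSpan hspan
  have hb : ∀ i, p (b i) := fun i => Module.Basis.ofSpan_subset hspan ⟨i, rfl⟩
  let B : V →ₗ[ℝ] V →ₗ[ℝ] Q := b.constr ℝ (J ∘ b)
  have hB : ∀ᵐ w ∂μ, B.flip w = -J w := by
    filter_upwards [ae_all_iff.2 fun i => hJ _ (hb i)] with w hw
    exact b.ext fun i => by simpa [B, b.constr_basis] using hw i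
  have hJB : ∀ u, p u → J u = B u := fun u hu => linearMap_ext_ae (μ := μ) <| by
    filter_upwards [hJ u hu, hB] with w hw hBw
    rw [hw, ← LinearMap.flip_apply, hBw, LinearMap.neg_apply]
  have hflip : B.flip = -B := linearMap_ext_ae (μ := μ) <| by
    filter_upwards [hp, hB] with w hw hBw
    rw [hBw, hJB w hw, LinearMap.neg_apply]
  have : IsAddTorsionFree Q := .of_isTorsionFree ℝ Q
  exact ⟨B, fun u => self_eq_neg.1 (LinearMap.congr_fun₂ hflip u u), hJB⟩

theorem exists_isAlt_eq_add_of_slide {h : V → V →ₗ[ℝ] Q} {p : V → Prop} (hp : ∀ᵐ x ∂μ, p x)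
    (slide : ∀ x, p x → ∀ᵐ y ∂μ, h y (y - x) = h x (y - x)) :
    ∃ (c : V →ₗ[ℝ] Q) (B : V →ₗ[ℝ] V →ₗ[ℝ] Q), B.IsAlt ∧ ∀ x, p x → h x = c + B x := by
  have expand : ∀ x, p x → ∃ B : V →ₗ[ℝ] V →ₗ[ℝ] Q, B.IsAlt ∧
      ∀ y, p y → h y (y - x) = h x (y - x) → h y - h x = B (y - x) := by
    intro x hx
    -- Sliding between any two of `x`, `x + u`, `x + w` gives `J u w = -J w u`.
    obtain ⟨B, hB, hJ⟩ := exists_isAlt_of_ae_eq_neg (μ := μ) (J := fun u => h (x + u) - h x)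
      (p := fun u => p (x + u) ∧ h (x + u) u = h x u)
      (by simpa only [add_sub_cancel_left] using
        (eventually_add_left_iff μ x).2 (hp.and (slide x hx))) <| by
        rintro u ⟨hu, hxu⟩
        filter_upwards [(eventually_add_left_iff μ x).2 (slide x hx),
            (eventually_add_left_iff μ x).2 (slide _ hu)] with w hxw huw
        simp only [add_sub_cancel_left, add_sub_add_left_eq_sub, map_sub,
          LinearMap.sub_apply] at hxw huw ⊢
        rw [hxu, hxw] at huw
        grind
    exact ⟨B, hB, fun y hy hxy => by
      simpa using hJ (y - x) (by simpa only [add_sub_cancel] using ⟨hy, hxy⟩)⟩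
  obtain ⟨x₀, hx₀⟩ := hp.exists
  obtain ⟨B, hB, hexp⟩ := expand x₀ hx₀
  refine ⟨h x₀ - B x₀, B, hB, fun x hx => ?_⟩
  obtain ⟨B', -, hexp'⟩ := expand x hx
  have key : ∀ᵐ y ∂μ, (B - B') y = h x - h x₀ + B x₀ - B' x := by
    filter_upwards [hp, slide x₀ hx₀, slide x hx] with y hy hy₀ hyx
    have h₀ := hexp y hy hy₀
    have h₁ := hexp' y hy hyx
    rw [map_sub] at h₀ h₁
    rw [LinearMap.sub_apply]
    grind
  have hBB' : B' = B := (sub_eq_zero.1 (linearMap_eq_zero_of_ae_eq_const key)).symm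
  obtain ⟨y, hy⟩ := key.exists
  rw [hBB', sub_self, LinearMap.zero_apply] at hy
  rw [← sub_eq_zero, hy]
  abel

theorem exists_isAlt_eq_add_of_symm_slide {U : V → V → Prop} {h : V → V → V →ₗ[ℝ] Q}
    (hsymm : ∀ x y, U x y → U y x) (hgen : ∀ x y, U x y → ∀ᵐ z ∂μ, U z y)
    (symm : ∀ x y, U x y → h x y = h y x)
    (slide : ∀ x y, U x y → ∀ᵐ z ∂μ, h z y (z - x) = h x y (z - x)) :
    ∃ (δ : V →ₗ[ℝ] Q) (B : V →ₗ[ℝ] V →ₗ[ℝ] Q), B.IsAlt ∧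
      ∀ x y, U x y → h x y = δ + B (x + y) := by
  by_cases hne : ∃ x₀ y₀, U x₀ y₀
  swap
  · exact ⟨0, 0, fun _ => rfl, fun x y hxy => (hne ⟨x, y, hxy⟩).elim⟩
  obtain ⟨x₀, y₀, h₀⟩ := hne
  have one_variable : ∀ y, ∃ (c : V →ₗ[ℝ] Q) (B : V →ₗ[ℝ] V →ₗ[ℝ] Q), ∀ x, U x y →
      B.IsAlt ∧ ∀ z, U z y → h z y = c + B z := by
    intro y
    by_cases hy : ∃ x, U x y
    · obtain ⟨x, hxy⟩ := hy
      obtain ⟨c, B, hB, hc⟩ := exists_isAlt_eq_add_of_slide (hgen x y hxy) fun z => slide z y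
      exact ⟨c, B, fun _ _ => ⟨hB, hc⟩⟩
    · exact ⟨0, 0, fun x hxy => (hy ⟨x, hxy⟩).elim⟩
  choose c B hcB using one_variable
  have hB : ∀ x y, U x y → B y = B y₀ := fun x y hxy =>
    eq_of_affine_compatible hsymm hgen (fun x y hxy => (hcB y x hxy).1)
      (fun x y hxy => by
        rw [← (hcB y x hxy).2 x hxy, symm x y hxy]
        exact (hcB x y (hsymm x y hxy)).2 y (hsymm x y hxy)) hxy h₀
  have hc : ∀ x y, U x y → c y - B y₀ y = c x - B y₀ x := by
    intro x y hxy
    have h₁ := (hcB y x hxy).2 x hxy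
    have h₂ := (hcB x y (hsymm x y hxy)).2 y (hsymm x y hxy)
    rw [hB x y hxy] at h₁
    rw [hB y x (hsymm x y hxy), ← symm x y hxy] at h₂
    grind
  refine ⟨c y₀ - B y₀ y₀, B y₀, (hcB y₀ x₀ h₀).1, fun x y hxy => ?_⟩
  obtain ⟨z, hzy, hzy₀⟩ := ((hgen x y hxy).and (hgen x₀ y₀ h₀)).exists
  rw [(hcB y x hxy).2 x hxy, hB x y hxy, hc z y₀ hzy₀, ← hc z y hzy, map_add]
  abel

end AlmostEverywhere

section GenericPosition

variable {V : Type*} [NormedAddCommGroup V] [NormedSpace ℝ V] [FiniteDimensional ℝ V]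
  {ι : Type*}

theorem ae_affineIndependent_update [DecidableEq ι] [MeasurableSpace V] [BorelSpace V]
    {μ : Measure V} [μ.IsAddHaarMeasure] {a : ι → V} (ha : AffineIndependent ℝ a) (i : ι) :
    ∀ᵐ y ∂μ, AffineIndependent ℝ (Function.update a i y) := by
  have hne : affineSpan ℝ (a '' {i}ᶜ) ≠ ⊤ := fun htop =>
    ha.notMem_affineSpan_sdiff i Set.univ (by
      rw [← Set.compl_eq_univ_sdiff, htop]; exact AffineSubspace.mem_top ℝ V _)
  filter_upwards [measure_eq_zero_iff_ae_notMem.1 (Measure.addHaar_affineSubspace μ _ hne)]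
    with y hy
  exact ha.affineIndependent_update_of_notMem_affineSpan hy

theorem ae_notMem_affineSpan_range [Fintype ι] [MeasurableSpace V] [BorelSpace V]
    {μ : Measure V} [μ.IsAddHaarMeasure] (hd : Fintype.card ι ≤ Module.finrank ℝ V) (a : ι → V) :
    ∀ᵐ y ∂μ, y ∉ affineSpan ℝ (Set.range a) := by
  refine measure_eq_zero_iff_ae_notMem.1 (Measure.addHaar_affineSubspace μ _ fun htop => ?_)
  cases isEmpty_or_nonempty ι with
  | inl _ =>
    rw [Set.range_eq_empty, AffineSubspace.span_empty] at htop
    exact AffineSubspace.bot_ne_top ℝ V V htop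
  | inr _ =>
    have hlt := finrank_vectorSpan_range_add_one_le ℝ a
    rw [← direction_affineSpan, htop, AffineSubspace.direction_top, finrank_top] at hlt
    lia

theorem affineIndependent_induction [Finite ι] [DecidableEq ι] {p : (ι → V) → Prop}
    (hp : ∀ a i y, AffineIndependent ℝ a → AffineIndependent ℝ (Function.update a i y) →
      p a → p (Function.update a i y))
    {a b : ι → V} (ha : AffineIndependent ℝ a) (hb : AffineIndependent ℝ b) (hpa : p a) : p b := by
  have := Fintype.ofFinite ι
  borelize V
  suffices h : ∀ (s : Finset ι) (a b : ι → V), AffineIndependent ℝ a → AffineIndependent ℝ b →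
      (∀ i ∉ s, a i = b i) → p a → p b from
    h Finset.univ a b ha hb (fun i hi => absurd (Finset.mem_univ i) hi) hpa
  intro s
  induction s using Finset.induction_on with
  | empty => exact fun a b _ _ hab => (funext fun i => hab i (Finset.notMem_empty i)) ▸ id
  | insert i s _ ih =>
    intro a b ha hb hab hpa
    obtain ⟨y, hay, hby⟩ := ((ae_affineIndependent_update (μ := Measure.addHaar) ha i).and
      (ae_affineIndependent_update hb i)).exists
    have hpb : p (Function.update b i y) := by
      refine ih _ _ hay hby (fun j hj => ?_) (hp a i y ha hay hpa)
      rcases eq_or_ne j i with rfl | hji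
      · simp
      · simpa [hji] using hab j (by simp [hji, hj])
    simpa using hp (Function.update b i y) i (b i) hby (by simpa using hb) hpb

end GenericPosition

section Sliding

variable {V Q : Type*} [AddCommGroup V] [Module ℝ V] [AddCommGroup Q] [Module ℝ Q]
  {ι : Type*} [DecidableEq ι]

/-- The sliding property of `g`, where `g a F` is thought of as the class of the force `F` acting on
the simplex with vertices `a i` (in any order): when the vertex `a i` moves to a point `y` off the
affine span of the simplex, the class of a force parallel to the motion does not change. -/
structure Sliding (g : (ι → V) → V →ₗ[ℝ] Q) : Prop where
  comp_perm : ∀ (a : ι → V) (σ : Equiv.Perm ι), g (a ∘ σ) = g a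
  slide : ∀ {a : ι → V} (i : ι) {y : V}, AffineIndependent ℝ a →
    y ∉ affineSpan ℝ (Set.range a) → g (Function.update a i y) (y - a i) = g a (y - a i)

variable [Fintype ι]

/-- As the vertex `i` of the simplex `a` moves, `g` is the affine function `δ + γ (∑ l, a l)` of the
sum of the vertices. Comparing the pairs `(δ, γ)` for different `a` and `i` makes them global. -/
def FitsAlong (g : (ι → V) → V →ₗ[ℝ] Q) (δ : V →ₗ[ℝ] Q) (γ : V →ₗ[ℝ] V →ₗ[ℝ] Q) (i : ι)
    (a : ι → V) : Prop :=
  ∀ x, AffineIndependent ℝ (Function.update a i x) →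
    g (Function.update a i x) = δ + γ (∑ l, Function.update a i x l)

theorem FitsAlong.eq {g : (ι → V) → V →ₗ[ℝ] Q} {δ : V →ₗ[ℝ] Q} {γ : V →ₗ[ℝ] V →ₗ[ℝ] Q}
    {a : ι → V} {i : ι} (h : FitsAlong g δ γ i a) (ha : AffineIndependent ℝ a) :
    g a = δ + γ (∑ l, a l) := by
  simpa using h (a i) (by simpa using ha)

end Sliding

section SlidingClassification

variable {V : Type*} [NormedAddCommGroup V] [NormedSpace ℝ V] [FiniteDimensional ℝ V]
  {Q : Type*} [AddCommGroup Q] [Module ℝ Q] {ι : Type*} [Fintype ι] [DecidableEq ι]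
  {g : (ι → V) → V →ₗ[ℝ] Q} {δ : V →ₗ[ℝ] Q} {γ : V →ₗ[ℝ] V →ₗ[ℝ] Q} {a : ι → V}

theorem FitsAlong.unique {δ' : V →ₗ[ℝ] Q} {γ' : V →ₗ[ℝ] V →ₗ[ℝ] Q} {i : ι}
    (h : FitsAlong g δ γ i a) (h' : FitsAlong g δ' γ' i a) (ha : AffineIndependent ℝ a) :
    δ = δ' ∧ γ = γ' := by
  borelize V
  have hγ : γ - γ' = 0 := by
    refine linearMap_eq_zero_of_ae_eq_const (μ := Measure.addHaar)
      (c := δ' - δ - (γ - γ') (∑ l ∈ Finset.univ \ {i}, a l)) ?_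
    filter_upwards [ae_affineIndependent_update ha i] with x hx
    have hx' := (h x hx).symm.trans (h' x hx)
    simp only [Finset.sum_update_of_mem (Finset.mem_univ i), map_add] at hx'
    simp only [LinearMap.sub_apply]
    grind
  rw [sub_eq_zero] at hγ
  subst hγ
  exact ⟨add_right_cancel ((h.eq ha).symm.trans (h'.eq ha)), rfl⟩

theorem Sliding.ae_slide (hg : Sliding g) (hd : Fintype.card ι ≤ Module.finrank ℝ V)
    [MeasurableSpace V] [BorelSpace V] {μ : Measure V} [μ.IsAddHaarMeasure] (i : ι) {x : V}
    (hx : AffineIndependent ℝ (Function.update a i x)) :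
    ∀ᵐ y ∂μ, g (Function.update a i y) (y - x) = g (Function.update a i x) (y - x) := by
  filter_upwards [ae_notMem_affineSpan_range hd (Function.update a i x)] with y hy
  simpa using hg.slide i hx hy

theorem Sliding.exists_fitsAlong (hg : Sliding g) (hd : Fintype.card ι ≤ Module.finrank ℝ V)
    (ha : AffineIndependent ℝ a) (i : ι) :
    ∃ (δ : V →ₗ[ℝ] Q) (γ : V →ₗ[ℝ] V →ₗ[ℝ] Q), γ.IsAlt ∧ FitsAlong g δ γ i a := by
  borelize V
  obtain ⟨c, γ, hγ, hc⟩ := exists_isAlt_eq_add_of_slide (μ := Measure.addHaar)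
    (ae_affineIndependent_update ha i) fun x => hg.ae_slide hd i
  refine ⟨c - γ (∑ l ∈ Finset.univ \ {i}, a l), γ, hγ, fun x hx => ?_⟩
  rw [hc x hx, Finset.sum_update_of_mem (Finset.mem_univ i), map_add]
  abel

theorem Sliding.exists_fitsAlong_update (hg : Sliding g) (hd : Fintype.card ι ≤ Module.finrank ℝ V)
    (a : ι → V) {i j : ι} (hij : i ≠ j) :
    ∃ (δ : V →ₗ[ℝ] Q) (γ : V →ₗ[ℝ] V →ₗ[ℝ] Q), γ.IsAlt ∧
      ∀ x, FitsAlong g δ γ j (Function.update a i x) := by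
  borelize V
  let b : V → V → ι → V := fun x y => Function.update (Function.update a i x) j y
  have hb : ∀ x y, b x y = Function.update (Function.update a j y) i x := fun x y =>
    Function.update_comm hij _ _ _
  have hswap : ∀ x y, b x y ∘ Equiv.swap i j = b y x := by
    intro x y
    ext l
    rcases eq_or_ne l i with rfl | hi
    · simp [b, hij]
    rcases eq_or_ne l j with rfl | hj
    · simp [b, hij]
    · simp [b, Equiv.swap_apply_of_ne_of_ne hi hj, hi, hj]
  obtain ⟨δ, γ, hγ, h⟩ := exists_isAlt_eq_add_of_symm_slide (μ := Measure.addHaar)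
    (U := fun x y => AffineIndependent ℝ (b x y)) (h := fun x y => g (b x y))
    (fun x y hxy => hswap x y ▸ (affineIndependent_equiv (Equiv.swap i j)).2 hxy)
    (fun x y hxy => by
      filter_upwards [ae_affineIndependent_update hxy i] with z hz
      simpa [hb] using hz)
    (fun x y _ => by rw [← hswap, hg.comp_perm])
    (fun x y hxy => by
      rw [hb] at hxy
      simpa only [hb] using hg.ae_slide hd i hxy)
  refine ⟨δ - γ (∑ l ∈ (Finset.univ \ {j}) \ {i}, a l), γ, hγ, fun x y hxy => (h x y hxy).trans ?_⟩
  rw [Finset.sum_update_of_mem (Finset.mem_univ j),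
    Finset.sum_update_of_mem (by simpa using hij)]
  simp only [map_add]
  abel

theorem Sliding.fitsAlong (hg : Sliding g) (hd : Fintype.card ι ≤ Module.finrank ℝ V)
    (ha : AffineIndependent ℝ a) {i : ι} (h : FitsAlong g δ γ i a) (j : ι) :
    FitsAlong g δ γ j a := by
  rcases eq_or_ne i j with rfl | hij
  · exact h
  obtain ⟨δ', γ', -, h'⟩ := hg.exists_fitsAlong_update hd a hij
  have hi : FitsAlong g δ' γ' i a := by
    intro x hx
    exact (h' x).eq hx
  obtain ⟨rfl, rfl⟩ := h.unique hi ha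
  simpa using h' (a i)

theorem Sliding.exists_isAlt_eq_add [Nonempty ι] (hg : Sliding g)
    (hd : Fintype.card ι ≤ Module.finrank ℝ V) :
    ∃ (δ : V →ₗ[ℝ] Q) (γ : V →ₗ[ℝ] V →ₗ[ℝ] Q), γ.IsAlt ∧
      ∀ a, AffineIndependent ℝ a → g a = δ + γ (∑ i, a i) := by
  by_cases hne : ∃ a : ι → V, AffineIndependent ℝ a
  swap
  · exact ⟨0, 0, fun _ => rfl, fun a ha => (hne ⟨a, ha⟩).elim⟩
  obtain ⟨a, ha⟩ := hne
  obtain ⟨i⟩ := ‹Nonempty ι›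
  obtain ⟨δ, γ, hγ, h⟩ := hg.exists_fitsAlong hd ha i
  refine ⟨δ, γ, hγ, fun b hb => FitsAlong.eq (i := i) ?_ hb⟩
  refine affineIndependent_induction (p := FitsAlong g δ γ i) (fun a j y ha hay hfit => ?_) ha hb h
  refine hg.fitsAlong hd hay (i := j) ?_ i
  intro x hx
  simpa using hg.fitsAlong hd ha hfit j x (by simpa using hx)

end SlidingClassification

section GramDeterminant

variable {V : Type*} [NormedAddCommGroup V] [InnerProductSpace ℝ V]

theorem det_gram_sub_smul {ι : Type*} [Fintype ι] [DecidableEq ι] (w : ι → V) (r : ι)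
    (c : ι → ℝ) :
    (Matrix.gram ℝ fun j => w j - c j • w r).det = (1 - c r) ^ 2 * (Matrix.gram ℝ w).det := by
  let M : Matrix ι ι ℝ := 1 + Matrix.vecMulVec (-c) (Pi.single r 1)
  have hM : M.det = 1 - c r := by
    simp only [M]
    rw [Matrix.vecMulVec_eq Unit, Matrix.det_one_add_replicateCol_mul_replicateRow]
    simp [sub_eq_add_neg]
  have hgram : Matrix.gram ℝ (fun j => w j - c j • w r) = M * Matrix.gram ℝ w * M.transpose := by
    ext i j
    simp only [M, Matrix.gram_apply, inner_sub_left, inner_sub_right, real_inner_smul_left,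
      real_inner_smul_right, Matrix.transpose_add, Matrix.transpose_one, Matrix.transpose_vecMulVec,
      Matrix.add_mul, Matrix.mul_add, one_mul, mul_one, Matrix.vecMulVec_mul, Matrix.mul_vecMulVec,
      Matrix.single_one_vecMul, Matrix.mulVec_single_one, Matrix.add_apply, Matrix.vecMulVec_apply,
      Matrix.row_apply, Matrix.col_apply, Pi.neg_apply]
    ring
  rw [hgram, Matrix.det_mul, Matrix.det_mul, Matrix.det_transpose, hM]
  ring

theorem det_gram_sub_base {d : ℕ} (a : Fin (d + 1) → V) (q : Fin (d + 1)) :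
    (Matrix.gram ℝ fun j => a (q.succAbove j) - a q).det =
      (Matrix.gram ℝ fun j : Fin d => a j.succ - a 0).det := by
  induction q using Fin.induction with
  | zero => simp only [Fin.succAbove_zero]
  | succ r ih =>
    -- Moving the base from `r` to `r + 1` subtracts the edge between them from every other edge and
    -- reverses this edge itself, hence the coefficient `2`.
    have hbase : (fun j => a (r.succ.succAbove j) - a r.succ) = fun j =>
        (a (r.castSucc.succAbove j) - a r.castSucc) -
          (if j = r then (2 : ℝ) else 1) • (a (r.castSucc.succAbove r) - a r.castSucc) := by
      funext j
      rcases eq_or_ne j r with rfl | hj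
      · simp [two_smul]
      · have hface : r.succ.succAbove j = r.castSucc.succAbove j := by
          rcases lt_or_gt_of_ne hj with h | h
          · rw [Fin.succAbove_succ_of_le _ _ h.le, Fin.succAbove_castSucc_of_lt _ _ h]
          · rw [Fin.succAbove_succ_of_lt _ _ h, Fin.succAbove_castSucc_of_le _ _ h.le]
        simp [hj, hface]
    rw [hbase, det_gram_sub_smul (fun j => a (r.castSucc.succAbove j) - a r.castSucc) r
      (fun j => if j = r then 2 else 1), ih, if_pos rfl]
    norm_num

theorem det_gram_eq_inner_mul {d : ℕ} (w : Fin (d + 1) → V) (p : Fin (d + 1)) {y z : V}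
    (hw : w p = y + z) (hy : y ∈ Submodule.span ℝ (w '' {p}ᶜ))
    (hz : ∀ i, i ≠ p → ⟪z, w i⟫ = 0) :
    (Matrix.gram ℝ w).det =
      ⟪z, w p⟫ * (Matrix.gram ℝ fun i => w (p.succAbove i)).det := by
  let rowDet : V →ₗ[ℝ] ℝ :=
    (Matrix.detRowAlternating.toMultilinearMap.toLinearMap (Matrix.gram ℝ w) p).comp
      (LinearMap.pi fun j => (innerₗ V).flip (w j))
  have rowDet_apply : ∀ x, rowDet x = ((Matrix.gram ℝ w).updateRow p fun j => ⟪x, w j⟫).det :=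
    fun x => rfl
  have rowDet_span : rowDet y = 0 := by
    refine (Submodule.span_le (p := LinearMap.ker rowDet)).2 ?_ hy
    rintro _ ⟨i, hi, rfl⟩
    exact Matrix.det_updateRow_eq_zero (M := Matrix.gram ℝ w) (i := i) (j := p) hi
  have rowDet_self : rowDet (w p) = (Matrix.gram ℝ w).det :=
    congrArg Matrix.det (Matrix.updateRow_eq_self (Matrix.gram ℝ w) p)
  rw [← rowDet_self, hw, map_add, rowDet_span, zero_add, ← hw, rowDet_apply,
    Matrix.det_succ_row _ p, Finset.sum_eq_single p]
  · rw [Matrix.updateRow_self, Matrix.submatrix_updateRow_succAbove, Even.neg_one_pow ⟨_, rfl⟩,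
      one_mul]
    rfl
  · intro j _ hj
    simp [hz j hj]
  · simp

end GramDeterminant

section Altitude

variable {V : Type*} [NormedAddCommGroup V] [InnerProductSpace ℝ V] {d : ℕ} [NeZero d]

theorem altitudeFoot_sub_mem_span (s : Affine.Simplex ℝ V d) {p q : Fin (d + 1)} (hpq : p ≠ q) :
    s.altitudeFoot p - s.points q ∈
      Submodule.span ℝ ((fun i => s.points i - s.points q) '' {p}ᶜ) := by
  have hq : s.points q ∈ s.points '' {p}ᶜ := Set.mem_image_of_mem _ hpq.symm
  have h := vsub_mem_vectorSpan_of_mem_affineSpan_of_mem_affineSpan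
    (s.altitudeFoot_mem_affineSpan_image_compl p) (mem_affineSpan ℝ hq)
  rw [vectorSpan_eq_span_vsub_set_right ℝ hq] at h
  simpa only [Set.image_image, vsub_eq_sub] using h

theorem inner_altitude_sub_eq_zero (s : Affine.Simplex ℝ V d) {p i j : Fin (d + 1)}
    (hi : p ≠ i) (hj : p ≠ j) :
    ⟪s.points p - s.altitudeFoot p, s.points i - s.points j⟫ = 0 := by
  have h1 := s.inner_vsub_altitudeFoot_vsub_altitudeFoot_eq_zero hi
  have h2 := s.inner_vsub_altitudeFoot_vsub_altitudeFoot_eq_zero hj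
  simp only [vsub_eq_sub] at h1 h2
  rw [real_inner_comm, ← sub_sub_sub_cancel_right _ _ (s.altitudeFoot p), inner_sub_left,
    h1, h2, sub_zero]

end Altitude

variable {n d : ℕ}

local notation "E" => EuclideanSpace ℝ (Fin n)

section Area

theorem area_eq_sqrt_det_gram_sub (s : Affine.Simplex ℝ E d) (q : Fin (d + 1)) :
    area s = √(Matrix.gram ℝ fun j => s.points (q.succAbove j) - s.points q).det /
      d.factorial := by
  rw [det_gram_sub_base, area]

theorem area_pos (s : Affine.Simplex ℝ E d) : 0 < area s := by
  have hindep := (affineIndependent_iff_linearIndependent_vsub ℝ _ 0).1 s.independent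
  have hedges : LinearIndependent ℝ fun j : Fin d => s.points j.succ - s.points 0 :=
    hindep.comp (fun j : Fin d => ⟨j.succ, Fin.succ_ne_zero j⟩)
      fun i j hij => Fin.succ_injective _ (Subtype.ext_iff.1 hij)
  exact div_pos (Real.sqrt_pos.2 (Matrix.posDef_gram_of_linearIndependent hedges).det_pos)
    (by positivity)

theorem area_faceOpposite_mul_height (s : Affine.Simplex ℝ E (d + 1))
    (p : Fin (d + 2)) :
    area (s.faceOpposite p) * s.height p = (d + 1) * area s := by
  obtain ⟨q, hqp⟩ := exists_ne p
  obtain ⟨r, rfl⟩ := Fin.exists_succAbove_eq hqp.symm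
  have hdet := det_gram_eq_inner_mul (fun j => s.points (q.succAbove j) - s.points q) r
    (y := s.altitudeFoot (q.succAbove r) - s.points q)
    (z := s.points (q.succAbove r) - s.altitudeFoot (q.succAbove r)) (by abel) ?_
    fun i hi => inner_altitude_sub_eq_zero s
      (fun h => hi (Fin.succAbove_right_injective h.symm)) hqp.symm
  · have hheight := s.inner_vsub_vsub_altitudeFoot_eq_height_sq hqp.symm
    simp only [vsub_eq_sub] at hheight
    rw [real_inner_comm, hheight] at hdet
    have hface : (fun i => s.points (q.succAbove (r.succAbove i)) - s.points q) =
      fun i => (s.faceOpposite (q.succAbove r)).points ((r.predAbove q).succAbove i) -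
        (s.faceOpposite (q.succAbove r)).points (r.predAbove q) := by
      funext i
      simp only [Affine.Simplex.faceOpposite_point_eq_point_succAbove]
      exact congrArg₂ (fun u v => s.points u - s.points v)
        (Fin.succAbove_succAbove_succAbove_predAbove q r i).symm
        (Fin.succAbove_succAbove_predAbove q r).symm
    rw [area_eq_sqrt_det_gram_sub s q, hdet, area_eq_sqrt_det_gram_sub _ (r.predAbove q),
      Real.sqrt_mul (sq_nonneg _), Real.sqrt_sq (s.height_pos _).le, hface, Nat.factorial_succ]
    push_cast
    field_simp
  · refine Submodule.span_le.2 ?_ (altitudeFoot_sub_mem_span s hqp.symm)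
    rintro _ ⟨i, hi, rfl⟩
    rcases eq_or_ne i q with rfl | hiq
    · simp
    · obtain ⟨j, rfl⟩ := Fin.exists_succAbove_eq hiq
      exact Submodule.subset_span ⟨j, fun hj => hi (congrArg q.succAbove hj), rfl⟩

end Area

section RankOneStress

variable {k : ℕ}

/-- The simplex `s` with the stress `e eᵀ`, a pure tension in the direction `e`. -/
def rankOneStress (s : Affine.Simplex ℝ E k) (e : E) : StressedSimplex n k where
  simplex := s
  stress := Matrix.vecMulVec e e
  isSymm := Matrix.transpose_vecMulVec _ _

theorem toEuclideanLin_rankOneStress (s : Affine.Simplex ℝ E k) (e v : E) :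
    Matrix.toEuclideanLin (rankOneStress s e).stress v = ⟪e, v⟫ • e := by
  ext i
  simp [rankOneStress, Matrix.vecMulVec_mulVec, PiLp.inner_apply, dotProduct, mul_comm]

theorem rankOneStress_isStructural {s : Affine.Simplex ℝ E k} {e : E}
    (he : e ∈ (affineSpan ℝ (Set.range s.points)).direction) :
    (rankOneStress s e).IsStructural := by
  intro c v hc _ hv
  rw [toEuclideanLin_rankOneStress] at hv
  rw [← inv_smul_smul₀ hc v, ← hv]
  exact Submodule.smul_mem _ _ (Submodule.smul_mem _ _ he)

variable [NeZero k]

theorem inner_sub_outwardNormal (s : Affine.Simplex ℝ E k) (i j : Fin (k + 1)) :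
    ⟪s.points j - s.points i, outwardNormal s i⟫ = if j = i then 0 else s.height i := by
  split_ifs with h
  · simp [h]
  · have hheight := s.inner_vsub_vsub_altitudeFoot_eq_height_sq (Ne.symm h)
    simp only [vsub_eq_sub] at hheight
    rw [outwardNormal, real_inner_smul_right, ← neg_sub (s.points i) (s.points j),
      ← neg_sub (s.points i) (s.altitudeFoot i), inner_neg_neg, hheight, pow_two,
      inv_mul_cancel_left₀ (s.height_pos i).ne']

theorem facetForce_rankOneStress (s : Affine.Simplex ℝ E k) (e : E) (i : Fin (k + 1)) :
    (rankOneStress s e).facetForce i =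
      (area (s.faceOpposite i) * ⟪e, outwardNormal s i⟫) • e := by
  rw [StressedSimplex.facetForce, toEuclideanLin_rankOneStress, smul_smul]
  rfl

theorem facetForce_rankOneStress_edge (s : Affine.Simplex ℝ E (d + 1)) (p q i : Fin (d + 2)) :
    (rankOneStress s (s.points p - s.points q)).facetForce i =
      ((d + 1) * area s) • (if i = q then s.points p - s.points q else 0) -
      ((d + 1) * area s) • (if i = p then s.points p - s.points q else 0) := by
  rw [facetForce_rankOneStress, ← area_faceOpposite_mul_height s i]
  nth_rw 1 [← sub_sub_sub_cancel_right (s.points p) (s.points q) (s.points i)]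
  rw [inner_sub_left, inner_sub_outwardNormal, inner_sub_outwardNormal]
  simp only [@eq_comm _ _ i]
  split_ifs <;> simp

end RankOneStress

section BeamSpan

/-- The vector measure with constant density with respect to `μ`, linearly in the density.
It is zero when `μ` is infinite. -/
def constDensity {α V : Type*} [MeasurableSpace α] [NormedAddCommGroup V] [NormedSpace ℝ V]
    (μ : Measure α) : V →ₗ[ℝ] VectorMeasure α V where
  toFun F := μ.withDensityᵥ fun _ => F
  map_add' F G := by
    by_cases h : IsFiniteMeasure μ
    · exact withDensityᵥ_add (integrable_const F) (integrable_const G)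
    · have hzero (F : V) : (μ.withDensityᵥ fun _ => F) = 0 := by
        rcases eq_or_ne F 0 with rfl | hF
        · exact withDensityᵥ_zero
        · exact dif_neg fun hint => h ((integrable_const_iff.1 hint).resolve_left hF)
      rw [hzero, hzero, hzero, add_zero]
  map_smul' c F := withDensityᵥ_smul (fun _ => F) c

/-- The constant force `F` on a set `K`, linearly in `F`, as a pair of vector measures: with total
force `F`, and with density `F`. Treating both at once gives the same beams for both. -/
def setForce (d : ℕ) (K : Set E) : E →ₗ[ℝ] VectorMeasure E E × VectorMeasure E E :=
  (constDensity (ProbabilityTheory.cond μHE[d] K)).prod (constDensity (μHE[d].restrict K))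

/-- The two vector measures of a force system, normalized and not. -/
def ForceSystem.measures {d l : ℕ} (S : ForceSystem n d l) :
    VectorMeasure E E × VectorMeasure E E :=
  (S.uniformMeasure, S.densityMeasure)

theorem ForceSystem.measures_eq_sum {d l : ℕ} (S : ForceSystem n d l) :
    S.measures = ∑ i, setForce d (convexHull ℝ (Set.range (S.simplex i).points)) (S.force i) := by
  simp only [Affine.Simplex.convexHull_eq_closedInterior]
  rw [Prod.ext_iff, Prod.fst_sum, Prod.snd_sum]
  exact ⟨rfl, rfl⟩

/-- The stressed simplex with stress multiplied by `c`. -/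
def StressedSimplex.scale {k : ℕ} (P : StressedSimplex n k) (c : ℝ) : StressedSimplex n k where
  simplex := P.simplex
  stress := c • P.stress
  isSymm := P.isSymm.smul c

theorem StressedSimplex.IsStructural.scale {k : ℕ} {P : StressedSimplex n k}
    (h : P.IsStructural) (c : ℝ) : (P.scale c).IsStructural := by
  intro t v ht hv htv
  have hcv : c • Matrix.toEuclideanLin P.stress v = t • v := by
    rw [← htv]
    simp [StressedSimplex.scale]
  have hc : c ≠ 0 := by
    rintro rfl
    exact smul_ne_zero ht hv (by rw [← hcv, zero_smul])
  refine h (c⁻¹ * t) v (by positivity) hv ?_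
  rw [mul_smul, ← hcv, inv_smul_smul₀ hc]

variable {k : ℕ} [NeZero k]

theorem StressedSimplex.measures_beam_scale (P : StressedSimplex n k) (c : ℝ) :
    (P.scale c).beam.measures = c • P.beam.measures := by
  rw [ForceSystem.measures_eq_sum, ForceSystem.measures_eq_sum, Finset.smul_sum]
  refine Finset.sum_congr rfl fun i _ => ?_
  rw [← map_smul]
  congr 1
  simp only [beam, facetForce, scale, map_smul, LinearMap.smul_apply]
  rw [smul_comm]

variable (n k) in
/-- The pairs of vector measures spanned by the `k`-beams. -/
def beamSpan : Submodule ℝ (VectorMeasure E E × VectorMeasure E E) :=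
  Submodule.span ℝ {x | ∃ P : StressedSimplex n k, P.IsStructural ∧ P.beam.measures = x}

theorem exists_eq_sum_of_mem_beamSpan {x : VectorMeasure E E × VectorMeasure E E}
    (hx : x ∈ beamSpan n k) :
    ∃ (m : ℕ) (P : Fin m → StressedSimplex n k),
      (∀ j, (P j).IsStructural) ∧ x = ∑ j, (P j).beam.measures := by
  obtain ⟨m, c, v, rfl⟩ := Submodule.mem_span_set'.1 hx
  choose P hP hPv using fun j => (v j).2
  refine ⟨m, fun j => (P j).scale (c j), fun j => (hP j).scale (c j), ?_⟩
  simp only [StressedSimplex.measures_beam_scale, hPv]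

end BeamSpan

section ForceClass

variable (n d) in
/-- The class modulo `(d + 1)`-beams of the force `F` distributed uniformly over the simplex with
vertices `a i`, linearly in `F`. -/
def forceClass (a : Fin (d + 1) → E) :
    E →ₗ[ℝ] (VectorMeasure E E × VectorMeasure E E) ⧸ beamSpan n (d + 1) :=
  (beamSpan n (d + 1)).mkQ ∘ₗ setForce d (convexHull ℝ (Set.range a))

theorem forceClass_congr {a b : Fin (d + 1) → E} (h : Set.range a = Set.range b) :
    forceClass n d a = forceClass n d b := by
  rw [forceClass, h, forceClass]

theorem measures_beam_rankOneStress_edge (s : Affine.Simplex ℝ E (d + 1)) (p q : Fin (d + 2)) :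
    (rankOneStress s (s.points p - s.points q)).beam.measures =
      ((d + 1) * area s) •
        (setForce d (convexHull ℝ (Set.range (s.faceOpposite q).points))
            (s.points p - s.points q) -
          setForce d (convexHull ℝ (Set.range (s.faceOpposite p).points))
            (s.points p - s.points q)) := by
  rw [ForceSystem.measures_eq_sum]
  change ∑ i, setForce d (convexHull ℝ (Set.range (s.faceOpposite i).points))
    ((rankOneStress s (s.points p - s.points q)).facetForce i) = _
  simp only [facetForce_rankOneStress_edge, map_sub, map_smul, apply_ite (setForce d _), map_zero,
    Finset.sum_sub_distrib, ← Finset.smul_sum, Finset.sum_ite_eq', Finset.mem_univ, if_true,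
    smul_sub]

theorem forceClass_faceOpposite (s : Affine.Simplex ℝ E (d + 1)) (p q : Fin (d + 2)) :
    forceClass n d (s.faceOpposite p).points (s.points p - s.points q) =
      forceClass n d (s.faceOpposite q).points (s.points p - s.points q) := by
  refine ((Submodule.Quotient.eq _).2 ?_).symm
  have hc : (d + 1) * area s ≠ 0 := (mul_pos (by positivity) (area_pos s)).ne'
  rw [← Submodule.smul_mem_iff _ hc, ← measures_beam_rankOneStress_edge]
  refine Submodule.subset_span ⟨_, rankOneStress_isStructural ?_, rfl⟩
  exact AffineSubspace.vsub_mem_direction (mem_affineSpan ℝ (Set.mem_range_self p))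
    (mem_affineSpan ℝ (Set.mem_range_self q))

theorem affineIndependent_cons {𝕜 V P : Type*} [DivisionRing 𝕜] [AddCommGroup V] [Module 𝕜 V]
    [AddTorsor V P] {a : Fin d → P} {y : P} (ha : AffineIndependent 𝕜 a)
    (hy : y ∉ affineSpan 𝕜 (Set.range a)) :
    AffineIndependent 𝕜 (Fin.cons y a : Fin (d + 1) → P) := by
  refine AffineIndependent.affineIndependent_of_notMem_span (i := 0) ?_ ?_
  · rw [← affineIndependent_equiv (finSuccAboveEquiv 0)]
    exact ha
  · rw [← Set.compl_singleton_eq, ← Fin.range_succ, ← Set.range_comp]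
    exact hy

theorem cons_image_compl_succ {α : Type*} (a : Fin d → α) (i : Fin d) (y : α) :
    (Fin.cons y a : Fin (d + 1) → α) '' {i.succ}ᶜ = Set.range (Function.update a i y) := by
  apply Set.Subset.antisymm
  · rintro _ ⟨j, hj, rfl⟩
    cases j using Fin.cases with
    | zero => exact ⟨i, by simp⟩
    | succ j => exact ⟨j, Function.update_of_ne (fun h => hj (congrArg Fin.succ h)) y a⟩
  · rintro _ ⟨j, rfl⟩
    rcases eq_or_ne j i with rfl | hji
    · exact ⟨0, (Fin.succ_ne_zero j).symm, by simp⟩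
    · exact ⟨j.succ, by simpa using hji, by simp [hji]⟩

theorem sliding_forceClass : Sliding (forceClass n d) where
  comp_perm a σ := forceClass_congr (σ.surjective.range_comp a)
  slide {a} i {y} ha hy := by
    let s : Affine.Simplex ℝ E (d + 1) := ⟨Fin.cons y a, affineIndependent_cons ha hy⟩
    have hface_zero : forceClass n d (s.faceOpposite 0).points = forceClass n d a := by
      refine forceClass_congr ((s.range_faceOpposite_points 0).trans ?_)
      rw [← Fin.range_succ, ← Set.range_comp]
      rfl
    have hface_succ : forceClass n d (s.faceOpposite i.succ).points =
        forceClass n d (Function.update a i y) :=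
      forceClass_congr ((s.range_faceOpposite_points i.succ).trans (cons_image_compl_succ a i y))
    rw [← hface_zero, ← hface_succ]
    exact (forceClass_faceOpposite s 0 i.succ).symm

end ForceClass

section Equilibrium

variable {l : ℕ}

theorem exists_eq_comp_wedge {Q : Type*} [AddCommGroup Q] [Module ℝ Q]
    {γ : E →ₗ[ℝ] E →ₗ[ℝ] Q} (hγ : γ.IsAlt) :
    ∃ L : Matrix (Fin n) (Fin n) ℝ →ₗ[ℝ] Q, ∀ u v, γ u v = L (wedge u v) := by
  let b := (EuclideanSpace.basisFun (Fin n) ℝ).toBasis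
  let L : Matrix (Fin n) (Fin n) ℝ →ₗ[ℝ] Q :=
    ∑ p, ∑ q, (Matrix.entryLinearMap ℝ ℝ p q).smulRight (γ (b p) (b q))
  have hL (M : Matrix (Fin n) (Fin n) ℝ) : L M = ∑ p, ∑ q, M p q • γ (b p) (b q) := by
    simp [L]
  have hexp (u v : E) :
      γ u v = L (Matrix.of fun p q => u p * v q) := by
    conv_lhs => rw [← b.sum_repr u, ← b.sum_repr v]
    simp only [hL, map_sum, LinearMap.sum_apply, map_smul, LinearMap.smul_apply, Finset.smul_sum,
      smul_smul]
    rw [Finset.sum_comm]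
    simp [b, mul_comm]
  refine ⟨(2⁻¹ : ℝ) • L, fun u v => ?_⟩
  have hwedge : wedge u v = Matrix.of (fun p q => u p * v q) - Matrix.of fun p q => v p * u q := rfl
  rw [LinearMap.smul_apply, hwedge, map_sub, ← hexp, ← hexp, ← hγ.neg u v, sub_neg_eq_add,
    ← two_smul ℝ, inv_smul_smul₀ two_ne_zero]

theorem sum_points_eq_smul_centroid (s : Affine.Simplex ℝ E d) :
    ∑ i, s.points i = ((d : ℝ) + 1) • s.centroid := by
  have h := s.centroid_vsub_eq 0
  simp only [vsub_eq_sub, sub_zero] at h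
  rw [h, smul_inv_smul₀ (by positivity)]

theorem ForceSystem.InEquilibrium.measures_mem_beamSpan {S : ForceSystem n d l}
    (hS : S.InEquilibrium) (hn : d + 1 ≤ n) : S.measures ∈ beamSpan n (d + 1) := by
  obtain ⟨δ, γ, hγ, hclass⟩ := sliding_forceClass.exists_isAlt_eq_add (g := forceClass n d)
    (by rwa [Fintype.card_fin, finrank_euclideanSpace_fin])
  obtain ⟨L, hL⟩ := exists_eq_comp_wedge hγ
  have hforce (i : Fin l) : forceClass n d (S.simplex i).points (S.force i) =
      δ (S.force i) - ((d : ℝ) + 1) • L (wedge (S.force i) (S.simplex i).centroid) := by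
    rw [hclass _ (S.simplex i).independent, sum_points_eq_smul_centroid, map_smul,
      LinearMap.add_apply, LinearMap.smul_apply, ← hγ.neg, hL, smul_neg, sub_eq_add_neg]
  rw [← Submodule.Quotient.mk_eq_zero, ← Submodule.mkQ_apply, S.measures_eq_sum, map_sum]
  calc ∑ i, forceClass n d (S.simplex i).points (S.force i)
      = δ (∑ i, S.force i) -
          ((d : ℝ) + 1) • L (∑ i, wedge (S.force i) (S.simplex i).centroid) := by
        simp only [hforce, Finset.sum_sub_distrib, ← Finset.smul_sum, map_sum]
    _ = 0 := by rw [hS.1, hS.2, map_zero, map_zero, smul_zero, sub_zero]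

end Equilibrium

end Beams

end

theorem mainTheorem1_general (k n l : ℕ) [NeZero k] (hn : k ≤ n)
    (S : Beams.ForceSystem n (k - 1) l) (hS : S.InEquilibrium) :
    ∃ (m : ℕ) (P : Fin m → Beams.StressedSimplex n k),
      (∀ j, (P j).IsStructural) ∧
      S.uniformMeasure = ∑ j, (P j).beam.uniformMeasure ∧
      S.densityMeasure = ∑ j, (P j).beam.densityMeasure := by
  obtain ⟨d, rfl⟩ := Nat.exists_eq_succ_of_ne_zero (NeZero.ne k)
  obtain ⟨m, P, hP, h⟩ := Beams.exists_eq_sum_of_mem_beamSpan (hS.measures_mem_beamSpan hn)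
  refine ⟨m, P, hP, ?_, ?_⟩
  · exact (congrArg Prod.fst h).trans Prod.fst_sum
  · exact (congrArg Prod.snd h).trans Prod.snd_sum

theorem mainTheorem1 (k n l : ℕ) [NeZero k] (hn : k + 1 ≤ n)
    (S : Beams.ForceSystem n (k - 1) l) (hS : S.InEquilibrium) :
    ∃ (m : ℕ) (P : Fin m → Beams.StressedSimplex n k),
      (∀ j, (P j).IsStructural) ∧
      S.uniformMeasure = ∑ j, (P j).beam.uniformMeasure ∧
      S.densityMeasure = ∑ j, (P j).beam.densityMeasure :=
  mainTheorem1_general k n l (by lia) S hS
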